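/- (In ZFC.) Let $[0,1]$ carry Lebesgue measure $\lambda$. There exists a family $\mathcal F$ of finite subsets of $[0,1]$ which is hereditary (if $B\subset A\in\mathcal F$ then $B\in\mathcal F$) and compact (the set $\{1_A : A\in\mathcal F\}$ of characteristic functions is compact in $\{0,1\}^{[0,1]}$ with the product topology) such that the Banach space $X=C(\mathcal F)$ of real-valued continuous functions on this compact space, with the sup norm, has the following properties. 1. $X$ is weakly compactly generated, i.e. some weakly compact subset of $X$ has dense linear span. 2. There is a function $f:[0,1]\to X$ such that * $f$ is scalarly null: for every $x^*\in X^*$ one has $x^*f=0$ $\lambda$-almost everywhere; * (consequently) $f$ is Pettis integrable: $x^*f$ is Lebesgue integrable for every $x^*\in X^*$, and for every Lebesgue measurable $E\subset[0,1]$ there is $x_E\in X$ with $x^*(x_E)=\int_E x^*f\,d\lambda$ for all $x^*\in X^*$; * $f$ is not McShane integrable. Here a function $f:[0,1]\to X$ is McShane integrable if there is $x\in X$ such that for every $\varepsilon>0$ there exist $\eta>0$ and an assignment $\delta$ of an open neighbourhood $\delta(t)$ in $[0,1]$ to each $t\in[0,1]$ such that $$\Bigl\|\sum_i\lambda(E_i)f(t_i)-x\Bigr\|\le\varepsilon$$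 for every finite family $(E_i)$ of pairwise disjoint Lebesgue measurable subsets of $[0,1]$ with $\lambda([0,1]\setminus\bigcup_iE_i)\le\eta$ and every choice of points $t_i\in[0,1]$ with $E_i\subset\delta(t_i)$ for all $i$. In particular, not every Pettis integrable function from $[0,1]$ to a weakly compactly generated Banach space is McShane integrable. -/

import Mathlib

open MeasureTheory

/-- A family of finite subsets of `S` is hereditary if it is closed under taking subsets. -/
def IsHereditary {S : Type*} (F : Set (Finset S)) : Prop :=
  ∀ A ∈ F, ∀ B : Finset S, B ⊆ A → B ∈ F

open Classical in
/-- The set `{1_A : A ∈ F}` of characteristic functions of the members of `F`, a subset of `2^S`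
(which carries the product topology of the discrete two-point space). -/
def charFunctions {S : Type*} (F : Set (Finset S)) : Set (S → Bool) :=
  {x | ∃ A ∈ F, x = fun s => decide (s ∈ A)}

/-- A family `F` of finite subsets of `S` is compact if `{1_A : A ∈ F}` is compact in `2^S`. -/
class IsCompactFamily {S : Type*} (F : Set (Finset S)) : Prop where
  isCompact_charFunctions : IsCompact (charFunctions F)

/-- A compact family, topologized as a subspace of `2^S`, is a compact space. Hence
`C(charFunctions F, ℝ)` is the Banach space `C(F)`, with the sup norm. -/
instance {S : Type*} (F : Set (Finset S)) [IsCompactFamily F] :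
    CompactSpace (charFunctions F) :=
  isCompact_iff_compactSpace.mp IsCompactFamily.isCompact_charFunctions

/-- A Banach space is weakly compactly generated if some weakly compact subset of it has dense
linear span. -/
def IsWCG (X : Type*) [NormedAddCommGroup X] [NormedSpace ℝ X] [CompleteSpace X] : Prop :=
  ∃ K : Set X, IsCompact (toWeakSpace ℝ X '' K) ∧ Dense (Submodule.span ℝ K : Set X)

section Integrals

variable {Ω : Type*} [MeasurableSpace Ω] {X : Type*} [NormedAddCommGroup X] [NormedSpace ℝ X]

/-- `f` is scalarly null if for each `φ` in the dual of `X`, `φ ∘ f` vanishes almost everywhere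
(the exceptional set may depend on `φ`). -/
def ScalarlyNull (μ : Measure Ω) (f : Ω → X) : Prop :=
  ∀ φ : StrongDual ℝ X, ∀ᵐ t ∂μ, φ (f t) = 0

/-- Pettis integrability. The sets that are measurable for the completion of `μ` are the
null-measurable ones. -/
def PettisIntegrable (μ : Measure Ω) (f : Ω → X) : Prop :=
  (∀ φ : StrongDual ℝ X, Integrable (fun t => φ (f t)) μ) ∧
    ∀ E : Set Ω, NullMeasurableSet E μ →
      ∃ x : X, ∀ φ : StrongDual ℝ X, φ x = ∫ t in E, φ (f t) ∂μ

/-- A gauge assigns to each point an open set that contains it. -/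
def IsGauge {Ω : Type*} [TopologicalSpace Ω] (δ : Ω → Set Ω) : Prop :=
  ∀ t, IsOpen (δ t) ∧ t ∈ δ t

/-- `f` is McShane integrable with integral `x`, for the completion of the probability measure `μ`:
for each `ε > 0` there are `η > 0` and a gauge `δ` such that `‖∑ i, μ (E i) • f (t i) - x‖ ≤ ε`
for every finite family of pairwise disjoint measurable sets `E i` whose union has a complement of
measure at most `η`, and all points `t i` (not necessarily in `E i`) with `E i ⊆ δ (t i)`. -/
def HasMcShaneIntegral [TopologicalSpace Ω] (μ : Measure Ω) [IsProbabilityMeasure μ]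
    (f : Ω → X) (x : X) : Prop :=
  ∀ ε : ℝ, 0 < ε → ∃ η : ℝ, 0 < η ∧ ∃ δ : Ω → Set Ω, IsGauge δ ∧
    ∀ (n : ℕ) (E : Fin n → Set Ω) (t : Fin n → Ω),
      (∀ i, NullMeasurableSet (E i) μ) →
      (∀ i j, i ≠ j → Disjoint (E i) (E j)) →
      μ.real (⋃ i, E i)ᶜ ≤ η →
      (∀ i, E i ⊆ δ (t i)) →
      ‖∑ i, μ.real (E i) • f (t i) - x‖ ≤ ε

/-- McShane integrability. -/
def McShaneIntegrable [TopologicalSpace Ω] (μ : Measure Ω) [IsProbabilityMeasure μ]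
    (f : Ω → X) : Prop :=
  ∃ x : X, HasMcShaneIntegral μ f x

end Integrals

/-!
The family consists of the finite sets on which an auxiliary function `φ : [0,1] → ℝ` is injective
and takes values that cluster: any two of the `n` values are at distance at most `1 / n`
(`clusterFamily`). It is compact, because the distance between two of the values bounds the
cardinality of the set. The function `f` sends `t` to the coordinate function `1_B ↦ [t ∈ B]`.

Scalar nullity and weak compact generation hold for the coordinate functions of each compact family.
The functions `1_B ↦ [A ⊆ B]`, for `A` finite, are point-finite, so by the representation of
functionals on `C(K)` by measures and dominated convergence they tend weakly to `0` along the
cofinite filter (`tendsto_subsetIndicator`). Hence they form, with `0`, a weakly compact set, whose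
span is dense by the Stone–Weierstrass theorem; and for each functional `ψ` only countably many `t`
have `ψ (f t) ≠ 0`.

The McShane integral fails because `φ` is chosen so wild that all of its fibres have outer measure
at least some `c > 0` (`exists_fibres_outer_measure_ge`; `φ` is additive, obtained from a Hamel
basis and restricted to `[0,1]`). Given a gauge `δ`, there is for each `u` an `r > 0` such that `δ
t` contains the `r`-ball about `t` for all `t` in a part of the fibre over `u` of outer measure more
than `c / 2`; the same `r` serves for infinitely many `u` in `[0,1]`, and among these there are
arbitrarily large sets of arbitrarily close values. Picking one point from each of sufficiently many
such fibres greedily produces a member `B` of the family with `⋃ t ∈ B, δ t` of measure at least `c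
/ 2` (`exists_mem_clusterFamily_measure_ge`). The Riemann sum of a partition that gives this union
to tags in `B` has value at least `c / 2` at `1_B`, whereas the integral could only be `0`.
-/

open Filter Topology
open scoped NNReal ENNReal

/-! ### Additive functions with non-null fibres -/

/-- A Hamel basis of `ℝ` can be indexed by `ℕ × I`; the `n`-th coordinate then takes values in the
finitely supported functions on `I`, which are a copy of `ℝ`. Each real has only finitely many
nonzero coordinates, so the kernels of these maps cover `ℝ`, and one of them is not null. -/
theorem exists_linearMap_surjective_ker_not_null :
    ∃ φ : ℝ →ₗ[ℚ] ℝ, Function.Surjective φ ∧ volume {x : ℝ | φ x = 0} ≠ 0 := by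
  let b := Module.Basis.ofVectorSpace ℚ ℝ
  have hinf : Infinite (Module.Basis.ofVectorSpaceIndex ℚ ℝ) := by
    by_contra hfin
    rw [not_infinite_iff_finite] at hfin
    have : Countable ℝ := b.equivFun.toEquiv.countable_iff.2 inferInstance
    exact not_countable this
  have hcard : Nonempty (Module.Basis.ofVectorSpaceIndex ℚ ℝ ≃
      ℕ × Module.Basis.ofVectorSpaceIndex ℚ ℝ) := by
    rw [← Cardinal.eq, Cardinal.mk_prod]
    simp
  obtain ⟨e⟩ := hcard
  let Ψ := (b.reindex e).repr ≪≫ₗ Finsupp.curryLinearEquiv ℚ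
  let φ : ℕ → ℝ →ₗ[ℚ] ℝ := fun n => b.repr.symm.toLinearMap ∘ₗ Finsupp.lapply n ∘ₗ Ψ.toLinearMap
  have hcover : (⋃ n, {x : ℝ | φ n x = 0}) = Set.univ := by
    refine Set.eq_univ_of_forall fun x => Set.mem_iUnion.2 ?_
    obtain ⟨n, hn⟩ := Infinite.exists_notMem_finset (Ψ x).support
    refine ⟨n, ?_⟩
    have : Ψ x n = 0 := Finsupp.notMem_support_iff.1 hn
    simp [φ, this]
  obtain ⟨n, hn⟩ : ∃ n, volume {x : ℝ | φ n x = 0} ≠ 0 := by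
    by_contra! h
    have := measure_iUnion_null h
    rw [hcover] at this
    simp at this
  refine ⟨φ n, fun y => ⟨Ψ.symm (Finsupp.single n (b.repr y)), ?_⟩, hn⟩
  simp [φ]

/-- There is a function on `[0,1]` each of whose fibres over `ℝ` has outer measure at least some
fixed positive number. -/
theorem exists_fibres_outer_measure_ge :
    ∃ (φ : unitInterval → ℝ) (c : ℝ≥0), 0 < c ∧ ∀ u : ℝ, (c : ℝ≥0∞) ≤ volume {t | φ t = u} := by
  obtain ⟨φ, hsurj, hker⟩ := exists_linearMap_surjective_ker_not_null
  obtain ⟨k, hk, hk0⟩ : ∃ k, φ k = 0 ∧ k ≠ 0 := by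
    by_contra! h
    exact hker (measure_mono_null (fun x hx => h x hx) (Real.volume_singleton (a := 0)))
  obtain ⟨j, hj⟩ : ∃ j : ℤ, volume ({x | φ x = 0} ∩ Set.Icc ((j : ℝ) / 2) ((j + 1) / 2)) ≠ 0 := by
    by_contra! h
    refine hker (measure_mono_null (fun x hx => ?_) (measure_iUnion_null h))
    refine Set.mem_iUnion.2 ⟨⌊2 * x⌋, hx, ?_, ?_⟩
    · linarith [Int.floor_le (2 * x)]
    · linarith [Int.lt_floor_add_one (2 * x)]
  set S := {x | φ x = 0} ∩ Set.Icc ((j : ℝ) / 2) ((j + 1) / 2)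
  have hfin : volume S ≠ ∞ :=
    ((measure_mono Set.inter_subset_right).trans_lt measure_Icc_lt_top).ne
  refine ⟨fun t => φ t, (volume S).toNNReal, ENNReal.toNNReal_pos hj hfin, fun u => ?_⟩
  rw [ENNReal.coe_toNNReal hfin, Measure.Subtype.volume_def,
    comap_subtype_coe_apply measurableSet_Icc]
  obtain ⟨x, hx⟩ := hsurj u
  -- Rational multiples of `k` stay in the kernel, so a fibre meets every interval.
  obtain ⟨y, hy, hy1, hy2⟩ : ∃ y, φ y = u ∧ -(j : ℝ) / 2 ≤ y ∧ y ≤ -(j : ℝ) / 2 + 1 / 2 := by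
    obtain ⟨q, hq1, hq2⟩ := exists_rat_btwn
      (show (-(j : ℝ) / 2 - x) / |k| < (-(j : ℝ) / 2 - x) / |k| + 1 / 2 / |k| by
        have := abs_pos.2 hk0
        linarith [show 0 < 1 / 2 / |k| by positivity])
    have hpos := abs_pos.2 hk0
    rw [← add_div, lt_div_iff₀ hpos] at hq2
    rw [div_lt_iff₀ hpos] at hq1
    refine ⟨x + q * |k|, ?_, by linarith, by linarith⟩
    have hkk : φ |k| = 0 := by
      rcases abs_choice k with h | h <;> rw [h] <;> simp [hk]
    rw [← Rat.smul_def, map_add, map_smul, hkk, hx]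
    simp
  calc volume S = volume ((fun z => y + z) '' S) := by
        rw [Set.image_add_left, measure_preimage_add]
    _ ≤ _ := by
        refine measure_mono ?_
        rintro _ ⟨z, ⟨hz, hz1, hz2⟩, rfl⟩
        refine ⟨⟨y + z, by constructor <;> linarith⟩, ?_, rfl⟩
        change φ z = 0 at hz
        simp [hz, hy]

/-! ### Compact families of finite sets -/

/-- A hereditary family of finite sets is compact as soon as no infinite set has all its finite
subsets in the family. -/
theorem IsHereditary.isCompactFamily {S : Type*} {F : Set (Finset S)} (hF : IsHereditary F)
    (h : ∀ x : Set S, x.Infinite → ∃ A : Finset S, (A : Set S) ⊆ x ∧ A ∉ F) :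
    IsCompactFamily F := by
  classical
  have heq : charFunctions F = ⋂ (A : Finset S) (_ : A ∉ F), (⋂ s ∈ A, {x : S → Bool | x s})ᶜ := by
    ext x
    simp only [charFunctions, Set.mem_ofPred_eq, Set.mem_iInter, Set.mem_compl_iff]
    constructor
    · rintro ⟨B, hB, rfl⟩ A hA hAB
      exact hA (hF B hB A fun s hs => by simpa using hAB s hs)
    · intro hx
      have hfin : {s | x s = true}.Finite := by
        by_contra hinf
        obtain ⟨A, hA, hAF⟩ := h _ hinf
        exact hx A hAF fun s hs => hA hs
      refine ⟨hfin.toFinset, ?_, ?_⟩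
      · by_contra hA
        exact hx _ hA fun s hs => by simpa using hs
      · ext s
        simp
  refine ⟨?_⟩
  rw [heq]
  refine IsClosed.isCompact (isClosed_iInter fun A => isClosed_iInter fun _ => ?_)
  refine (isOpen_biInter_finset fun s _ => ?_).isClosed_compl
  have hs : Continuous fun x : S → Bool => x s := continuous_apply s
  exact (isOpen_discrete {true}).preimage hs

/-- The finite sets `A` on which `φ` is injective, with values that are pairwise at distance at
most `1 / |A|`. Two points of `A` bound the cardinality of `A`, which makes the family compact. -/
def clusterFamily {S : Type*} (φ : S → ℝ) : Set (Finset S) :=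
  {A | ∀ s ∈ A, ∀ t ∈ A, s ≠ t → φ s ≠ φ t ∧ A.card * |φ s - φ t| ≤ 1}

theorem isHereditary_clusterFamily {S : Type*} (φ : S → ℝ) : IsHereditary (clusterFamily φ) := by
  intro A hA B hBA s hs t ht hst
  refine ⟨(hA s (hBA hs) t (hBA ht) hst).1, le_trans ?_ (hA s (hBA hs) t (hBA ht) hst).2⟩
  gcongr

theorem isCompactFamily_clusterFamily {S : Type*} (φ : S → ℝ) :
    IsCompactFamily (clusterFamily φ) := by
  classical
  refine (isHereditary_clusterFamily φ).isCompactFamily fun x hx => ?_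
  obtain ⟨s, hs, t, ht, hst⟩ := hx.nontrivial
  by_cases h : φ s = φ t
  · exact ⟨{s, t}, by simp [Set.insert_subset_iff, hs, ht],
      fun hA => (hA s (by simp) t (by simp) hst).1 h⟩
  obtain ⟨n, hn⟩ := exists_nat_gt (1 / |φ s - φ t|)
  obtain ⟨A, hA, hAn⟩ := hx.exists_subset_card_eq n
  refine ⟨insert s (insert t A), by simp [Set.insert_subset_iff, hs, ht, hA], fun hB => ?_⟩
  have h1 := (hB s (by simp) t (by simp) hst).2
  have hpos : 0 < |φ s - φ t| := abs_pos.2 (sub_ne_zero.2 h)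
  rw [div_lt_iff₀ hpos] at hn
  have h2 : n ≤ (insert s (insert t A)).card :=
    hAn ▸ Finset.card_le_card fun a ha => by simp [ha]
  have h3 : (n : ℝ) * |φ s - φ t| ≤ (insert s (insert t A)).card * |φ s - φ t| := by
    gcongr
  linarith

/-! ### Functionals on `C(K)` and pointwise convergence -/

section Variation

variable {K : Type*} [TopologicalSpace K] [CompactSpace K]

/-- The variation `|φ|` of a functional `φ` on `C(K)`, at a nonnegative function `f`: the supremum
of `φ g` over all `g` with `|g| ≤ f`. -/
noncomputable def variation (φ : StrongDual ℝ C(K, ℝ)) (f : C(K, ℝ≥0)) : ℝ :=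
  sSup {r | ∃ g : C(K, ℝ), (∀ x, |g x| ≤ f x) ∧ φ g = r}

theorem isLUB_variation (φ : StrongDual ℝ C(K, ℝ)) (f : C(K, ℝ≥0)) :
    IsLUB {r | ∃ g : C(K, ℝ), (∀ x, |g x| ≤ f x) ∧ φ g = r} (variation φ f) := by
  let f' : C(K, ℝ) := ⟨fun x => f x, by fun_prop⟩
  refine isLUB_csSup ⟨0, 0, by simp, by simp⟩ ⟨‖φ‖ * ‖f'‖, ?_⟩
  rintro _ ⟨g, hg, rfl⟩
  refine (le_abs_self _).trans ((φ.le_opNorm g).trans ?_)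
  gcongr
  refine (ContinuousMap.norm_le _ (norm_nonneg _)).2 fun x => (hg x).trans ?_
  exact (le_abs_self _).trans (f'.norm_coe_le_norm x)

theorem le_variation (φ : StrongDual ℝ C(K, ℝ)) {f : C(K, ℝ≥0)} {g : C(K, ℝ)}
    (h : ∀ x, |g x| ≤ f x) : φ g ≤ variation φ f :=
  (isLUB_variation φ f).1 ⟨g, h, rfl⟩

theorem variation_le (φ : StrongDual ℝ C(K, ℝ)) {f : C(K, ℝ≥0)} {M : ℝ}
    (h : ∀ g : C(K, ℝ), (∀ x, |g x| ≤ f x) → φ g ≤ M) : variation φ f ≤ M :=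
  (isLUB_variation φ f).2 (by rintro _ ⟨g, hg, rfl⟩; exact h g hg)

theorem variation_nonneg (φ : StrongDual ℝ C(K, ℝ)) (f : C(K, ℝ≥0)) : 0 ≤ variation φ f := by
  simpa using le_variation φ (f := f) (g := 0) (by simp)

theorem variation_add (φ : StrongDual ℝ C(K, ℝ)) (f₁ f₂ : C(K, ℝ≥0)) :
    variation φ (f₁ + f₂) = variation φ f₁ + variation φ f₂ := by
  apply le_antisymm
  · refine variation_le φ fun g hg => ?_
    -- Truncating `g` at `± f₁` splits it into a part below `f₁` and a part below `f₂`.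
    let g₁ : C(K, ℝ) := ⟨fun x => max (-(f₁ x : ℝ)) (min (g x) (f₁ x)), by fun_prop⟩
    have h₁ : ∀ x, |g₁ x| ≤ f₁ x := fun x => by
      have := (f₁ x).coe_nonneg
      refine abs_le.2 ⟨le_max_left _ _, max_le (by linarith) (min_le_right _ _)⟩
    have h₂ : ∀ x, |(g - g₁) x| ≤ f₂ x := fun x => by
      have h1 := (f₁ x).coe_nonneg
      have h2 := (f₂ x).coe_nonneg
      have h3 := abs_le.1 (hg x)
      simp only [ContinuousMap.add_apply, NNReal.coe_add] at h3
      change |g x - max (-(f₁ x : ℝ)) (min (g x) (f₁ x))| ≤ f₂ x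
      rw [abs_le]
      rcases max_cases (-(f₁ x : ℝ)) (min (g x) (f₁ x)) with h | h <;>
      rcases min_cases (g x) (f₁ x : ℝ) with h' | h' <;> constructor <;> linarith
    have := add_le_add (le_variation φ h₁) (le_variation φ h₂)
    rwa [← map_add, add_sub_cancel] at this
  · rw [← le_sub_iff_add_le]
    refine variation_le φ fun g₁ h₁ => ?_
    rw [le_sub_comm]
    refine variation_le φ fun g₂ h₂ => ?_
    rw [le_sub_iff_add_le, add_comm, ← map_add]
    refine le_variation φ fun x => ?_
    simpa using (abs_add_le _ _).trans (add_le_add (h₁ x) (h₂ x))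

theorem variation_smul (φ : StrongDual ℝ C(K, ℝ)) (c : ℝ≥0) (f : C(K, ℝ≥0)) :
    variation φ (c • f) = c * variation φ f := by
  have key : ∀ (c : ℝ≥0) (f : C(K, ℝ≥0)), c * variation φ f ≤ variation φ (c • f) := by
    intro c f
    rcases eq_or_ne c 0 with rfl | hc
    · simpa using variation_nonneg φ _
    have hc' : 0 < (c : ℝ) := by positivity
    rw [← le_div_iff₀' hc']
    refine variation_le φ fun g hg => ?_
    rw [le_div_iff₀' hc', ← smul_eq_mul, ← map_smul]
    refine le_variation φ fun x => ?_
    simpa [abs_mul] using mul_le_mul_of_nonneg_left (hg x) hc'.le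
  refine le_antisymm ?_ (key c f)
  rcases eq_or_ne c 0 with rfl | hc
  · refine variation_le φ fun g hg => ?_
    have : g = 0 := by
      ext x
      simpa using hg x
    simp [this]
  have hc' : 0 < (c : ℝ) := by positivity
  have := key c⁻¹ (c • f)
  rw [smul_smul, inv_mul_cancel₀ hc, one_smul, NNReal.coe_inv, inv_mul_le_iff₀ hc'] at this
  exact this

/-- By the Riesz–Markov–Kakutani theorem the variation of `φ` is integration against a measure. -/
theorem exists_measure_abs_le_integral [T2Space K] [MeasurableSpace K] [BorelSpace K]
    (φ : StrongDual ℝ C(K, ℝ)) :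
    ∃ μ : Measure K, IsFiniteMeasure μ ∧ ∀ g : C(K, ℝ), |φ g| ≤ ∫ x, |g x| ∂μ := by
  let Λ : CompactlySupportedContinuousMap K ℝ≥0 →ₗ[ℝ≥0] ℝ≥0 :=
    { toFun := fun f => ⟨variation φ f.toContinuousMap, variation_nonneg φ _⟩
      map_add' := fun f₁ f₂ => NNReal.eq (variation_add φ f₁.toContinuousMap f₂.toContinuousMap)
      map_smul' := fun c f => NNReal.eq (variation_smul φ c f.toContinuousMap) }
  refine ⟨NNRealRMK.rieszMeasure Λ, ⟨?_⟩, fun g => ?_⟩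
  · have h := NNRealRMK.lintegral_rieszMeasure Λ
      (CompactlySupportedContinuousMap.continuousMapEquiv (ContinuousMap.const K 1))
    simp only [CompactlySupportedContinuousMap.continuousMapEquiv_apply_toFun,
      ContinuousMap.const_apply, ENNReal.coe_one, lintegral_one] at h
    rw [h]
    exact ENNReal.coe_lt_top
  · let f : CompactlySupportedContinuousMap K ℝ≥0 :=
      CompactlySupportedContinuousMap.continuousMapEquiv ⟨fun x => ‖g x‖₊, by fun_prop⟩
    have h := NNRealRMK.integral_rieszMeasure Λ f
    have hΛ : (Λ f : ℝ) = variation φ f.toContinuousMap := rfl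
    change |φ g| ≤ ∫ x, (f x : ℝ) ∂(NNRealRMK.rieszMeasure Λ)
    rw [h, hΛ, abs_le']
    refine ⟨le_variation φ fun x => le_rfl, ?_⟩
    rw [← map_neg]
    exact le_variation φ fun x => (abs_neg _).le

/-- A bounded point-finite family in `C(K)` converges weakly to `0` along the cofinite filter. -/
theorem tendsto_cofinite_of_finite_ne_zero [T2Space K] {ι : Type*} (g : ι → C(K, ℝ))
    (hg : ∀ i x, |g i x| ≤ 1) (hfin : ∀ x, {i | g i x ≠ 0}.Finite) (φ : StrongDual ℝ C(K, ℝ)) :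
    Tendsto (fun i => φ (g i)) cofinite (𝓝 0) := by
  borelize K
  obtain ⟨μ, hμ, hφ⟩ := exists_measure_abs_le_integral φ
  rw [Metric.tendsto_nhds]
  intro ε hε
  by_contra hinf
  have hinf' : {i | ¬ dist (φ (g i)) 0 < ε}.Infinite := hinf
  let e := hinf'.natEmbedding
  have hlim : Tendsto (fun n => ∫ x, |g (e n) x| ∂μ) atTop (𝓝 (∫ _, (0 : ℝ) ∂μ)) := by
    refine tendsto_integral_of_dominated_convergence (fun _ => 1) (fun n => ?_)
      (integrable_const 1) (fun n => ?_) (Eventually.of_forall fun x => ?_)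
    · exact (g (e n)).continuous.abs.aestronglyMeasurable
    · exact Eventually.of_forall fun x => by simpa using hg _ x
    · refine tendsto_const_nhds.congr' ?_
      rw [← Nat.cofinite_eq_atTop]
      have : {n | g (e n) x ≠ 0}.Finite :=
        (hfin x).preimage ((Subtype.val_injective.comp e.injective).injOn)
      filter_upwards [this.compl_mem_cofinite] with n hn
      simp only [Set.mem_compl_iff, Set.mem_ofPred_eq, not_not] at hn
      simp [hn]
  rw [integral_zero] at hlim
  obtain ⟨n, hn⟩ := (hlim.eventually (gt_mem_nhds hε)).exists
  exact (e n).2 (by simpa using (hφ _).trans_lt hn)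

end Variation

/-! ### The space `C(F)` over a compact family -/

section CharFunctions

variable {S : Type*} (F : Set (Finset S))

open Classical in
/-- The continuous function `1_B ↦ [A ⊆ B]` on a family of finite sets. -/
noncomputable def subsetIndicator (A : Finset S) : C(charFunctions F, ℝ) :=
  ∏ s ∈ A, ⟨fun x => if x.1 s then 1 else 0,
    (continuous_of_discreteTopology (f := fun b : Bool => if b then (1 : ℝ) else 0)).comp
      ((continuous_apply s).comp continuous_subtype_val)⟩

variable {F}

open Classical in
theorem subsetIndicator_apply (A : Finset S) (x : charFunctions F) :
    subsetIndicator F A x = if ∀ s ∈ A, x.1 s then 1 else 0 := by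
  simp [subsetIndicator, ContinuousMap.coe_prod, Finset.prod_apply, Finset.prod_boole]

theorem subsetIndicator_mul (A B : Finset S) [DecidableEq S] :
    subsetIndicator F A * subsetIndicator F B = subsetIndicator F (A ∪ B) := by
  ext x
  simp only [ContinuousMap.mul_apply, subsetIndicator_apply, Finset.forall_mem_union, ite_and,
    ite_mul, one_mul, zero_mul]

variable [IsCompactFamily F]

theorem tendsto_subsetIndicator (φ : StrongDual ℝ C(charFunctions F, ℝ)) :
    Tendsto (fun A => φ (subsetIndicator F A)) cofinite (𝓝 0) := by
  classical
  refine tendsto_cofinite_of_finite_ne_zero _ (fun A x => ?_) (fun x => ?_) φ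
  · rw [subsetIndicator_apply]
    split_ifs <;> simp
  · obtain ⟨x, B, hB, rfl⟩ := x
    refine B.powerset.finite_toSet.subset fun A hA => ?_
    have : ∀ s ∈ A, decide (s ∈ B) = true := by
      by_contra h
      exact hA (by rw [subsetIndicator_apply, if_neg h])
    simpa [Finset.subset_iff] using this

/-- The functions `1_B ↦ [A ⊆ B]` together with `0` form a weakly compact set. They are closed under
multiplication, so by the Stone–Weierstrass theorem their span is dense. -/
theorem isWCG_of_isCompactFamily : IsWCG C(charFunctions F, ℝ) := by
  classical
  refine ⟨insert 0 (Set.range (subsetIndicator F)), ?_, ?_⟩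
  · rw [Set.image_insert_eq, ← Set.range_comp]
    refine Tendsto.isCompact_insert_range_of_cofinite ?_
    refine (WeakBilin.tendsto_iff_forall_eval_tendsto _ ?_).2 fun φ => ?_
    · intro x y hxy
      exact (SeparatingDual.eq_iff_forall_dual_eq (R := ℝ)).2 fun φ => DFunLike.congr_fun hxy φ
    · have h := tendsto_subsetIndicator φ
      rwa [← map_zero φ] at h
  · have hsep : (Algebra.adjoin ℝ (Set.range (subsetIndicator F))).SeparatesPoints := by
      intro x y hxy
      obtain ⟨s, hs⟩ : ∃ s, x.1 s ≠ y.1 s := by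
        by_contra! h
        exact hxy (Subtype.ext (funext h))
      refine ⟨_, ⟨subsetIndicator F {s}, Algebra.subset_adjoin ⟨_, rfl⟩, rfl⟩, fun h => hs ?_⟩
      simp only [subsetIndicator_apply, Finset.mem_singleton, forall_eq] at h
      cases hx : x.1 s <;> cases hy : y.1 s <;> simp [hx, hy] at h ⊢
    have htop := ContinuousMap.subalgebra_topologicalClosure_eq_top_of_separatesPoints _ hsep
    have hclosed : (Submonoid.closure (Set.range (subsetIndicator F)) : Set _) =
        Set.range (subsetIndicator F) := by
      refine Set.Subset.antisymm (fun g hg => ?_) Submonoid.subset_closure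
      induction hg using Submonoid.closure_induction with
      | mem g hg => exact hg
      | one => exact ⟨∅, by simp [subsetIndicator]⟩
      | mul g h _ _ hg hh =>
        obtain ⟨A, rfl⟩ := hg
        obtain ⟨B, rfl⟩ := hh
        exact ⟨A ∪ B, (subsetIndicator_mul A B).symm⟩
    have hdense : Dense ((Algebra.adjoin ℝ (Set.range (subsetIndicator F)) :
        Subalgebra ℝ C(charFunctions F, ℝ)) : Set C(charFunctions F, ℝ)) := by
      rw [dense_iff_closure_eq, ← Subalgebra.topologicalClosure_coe, htop]
      rfl
    refine hdense.mono ?_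
    rw [← Subalgebra.coe_toSubmodule, Algebra.adjoin_eq_span, hclosed]
    exact Submodule.span_mono (Set.subset_insert _ _)

end CharFunctions

/-! ### Gauges on the unit interval -/

/-- The cluster family of `φ` fills a fixed proportion of the interval for each gauge `δ`. Points
with `δ t` containing a ball of a common radius `r` meet infinitely many fibres in large sets;
infinitely many values `u` accumulate, so arbitrarily many of these fibres lie over values that are
as close together as the cluster family demands. As long as the sets `δ t` chosen so far are small,
they leave room for a further point from the next fibre at distance at least `r` from the previous
ones, and there is a bound on the number of such points. -/
theorem exists_mem_clusterFamily_measure_ge {φ : unitInterval → ℝ} {c : ℝ≥0} (hc : 0 < c)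
    (hφ : ∀ u : ℝ, (c : ℝ≥0∞) ≤ volume {t | φ t = u}) {δ : unitInterval → Set unitInterval}
    (hδ : IsGauge δ) :
    ∃ B ∈ clusterFamily φ, ((c / 2 : ℝ≥0) : ℝ≥0∞) ≤ volume (⋃ t ∈ B, δ t) := by
  classical
  let T : ℕ → Set unitInterval := fun k => {t | Metric.ball t (1 / (k + 1)) ⊆ δ t}
  have hTmono : Monotone T := fun k l hkl t ht =>
    (Metric.ball_subset_ball (one_div_le_one_div_of_le (by positivity) (by gcongr))).trans ht
  have hTex : ∀ t, ∃ k, t ∈ T k := fun t => by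
    obtain ⟨r, hr, hrt⟩ := Metric.isOpen_iff.1 (hδ t).1 t (hδ t).2
    obtain ⟨k, hk⟩ := exists_nat_one_div_lt hr
    exact ⟨k, (Metric.ball_subset_ball hk.le).trans hrt⟩
  have hk : ∀ u : ℝ, ∃ k, ((c / 2 : ℝ≥0) : ℝ≥0∞) < volume ({t | φ t = u} ∩ T k) := by
    intro u
    have hmono : Monotone fun k => {t | φ t = u} ∩ T k := fun k l hkl =>
      Set.inter_subset_inter_right _ (hTmono hkl)
    have hun : (⋃ k, {t | φ t = u} ∩ T k) = {t | φ t = u} := by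
      rw [← Set.inter_iUnion, Set.eq_univ_of_forall fun t => Set.mem_iUnion.2 (hTex t),
        Set.inter_univ]
    have hlt : ((c / 2 : ℝ≥0) : ℝ≥0∞) < volume (⋃ k, {t | φ t = u} ∩ T k) := by
      rw [hun]
      exact (ENNReal.coe_lt_coe.2 (NNReal.half_lt_self hc.ne')).trans_le (hφ u)
    rw [hmono.measure_iUnion] at hlt
    exact lt_iSup_iff.1 hlt
  obtain ⟨k, hkinf⟩ : ∃ k, {u ∈ Set.Icc (0 : ℝ) 1 |
      ((c / 2 : ℝ≥0) : ℝ≥0∞) < volume ({t | φ t = u} ∩ T k)}.Infinite := by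
    by_contra! h
    have hcount := Set.countable_iUnion fun k => (h k).countable
    refine (Cardinal.Real.Icc_countable_iff (x := 0) (y := 1)).not.2 (by norm_num)
      (hcount.mono fun u hu => ?_)
    obtain ⟨k, hk⟩ := hk u
    exact Set.mem_iUnion.2 ⟨k, hu, hk⟩
  set U := {u ∈ Set.Icc (0 : ℝ) 1 | ((c / 2 : ℝ≥0) : ℝ≥0∞) < volume ({t | φ t = u} ∩ T k)}
  obtain ⟨a, -, ha⟩ := hkinf.exists_accPt_of_subset_isCompact isCompact_Icc (Set.sep_subset _ _)
  have hinf : (Metric.ball a (1 / (2 * (k + 3))) ∩ U).Infinite :=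
    Set.Infinite.of_accPt (ha.nhds_inter (Metric.ball_mem_nhds a (by positivity)))
  obtain ⟨V, hVU, hVcard⟩ := hinf.exists_subset_card_eq (k + 3)
  obtain ⟨B, hBV, hBinj, hBT, hB⟩ : ∃ B : Finset unitInterval, (∀ t ∈ B, φ t ∈ V) ∧
      Set.InjOn φ B ∧ (∀ t ∈ B, t ∈ T k) ∧
      (((c / 2 : ℝ≥0) : ℝ≥0∞) ≤ volume (⋃ t ∈ B, δ t) ∨
        B.card = V.card ∧ ∀ s ∈ B, ∀ t ∈ B, s ≠ t → 1 / ((k : ℝ) + 1) ≤ dist s t) := by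
    have hVU' : ∀ u ∈ V, u ∈ U := fun u hu => (hVU hu).2
    clear hVU hVcard
    induction V using Finset.induction_on with
    | empty => exact ⟨∅, by simp⟩
    | insert u V huV ih =>
      obtain ⟨B, hBV, hBinj, hBT, hB⟩ := ih fun v hv => hVU' v (Finset.mem_insert_of_mem hv)
      rcases le_or_gt ((c / 2 : ℝ≥0) : ℝ≥0∞) (volume (⋃ t ∈ B, δ t)) with hle | hlt
      · exact ⟨B, fun t ht => Finset.mem_insert_of_mem (hBV t ht), hBinj, hBT, .inl hle⟩
      obtain ⟨hcard, hsep⟩ := hB.resolve_left hlt.not_ge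
      obtain ⟨t, ⟨htu, htT⟩, ht⟩ : ∃ t ∈ {t | φ t = u} ∩ T k, t ∉ ⋃ t ∈ B, δ t := by
        by_contra! h
        exact (hlt.trans (hVU' u (Finset.mem_insert_self _ _)).2).not_ge (measure_mono h)
      change φ t = u at htu
      have hdist : ∀ s ∈ B, 1 / ((k : ℝ) + 1) ≤ dist t s := fun s hs => by
        by_contra! hlt
        exact ht (Set.mem_biUnion hs (hBT s hs hlt))
      have htB : t ∉ B := fun h => huV (htu ▸ hBV t h)
      refine ⟨insert t B, ?_, ?_, ?_, .inr ⟨?_, ?_⟩⟩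
      · simp only [Finset.forall_mem_insert]
        exact ⟨htu ▸ Finset.mem_insert_self _ _, fun s hs => Finset.mem_insert_of_mem (hBV s hs)⟩
      · rw [Finset.coe_insert, Set.injOn_insert (by simpa using htB)]
        refine ⟨hBinj, ?_⟩
        rintro ⟨s, hs, hst⟩
        exact huV (htu ▸ hst ▸ hBV s hs)
      · simp only [Finset.forall_mem_insert]
        exact ⟨htT, hBT⟩
      · rw [Finset.card_insert_of_notMem htB, Finset.card_insert_of_notMem huV, hcard]
      · simp only [Finset.forall_mem_insert]
        exact ⟨⟨fun h => absurd rfl h, fun s hs _ => hdist s hs⟩,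
          fun s hs => ⟨fun _ => dist_comm s t ▸ hdist s hs, hsep s hs⟩⟩
  refine ⟨B, fun s hs t ht hst => ⟨fun h => hst (hBinj hs ht h), ?_⟩, hB.resolve_right ?_⟩
  · have hcard : B.card ≤ k + 3 := hVcard ▸ Finset.card_le_card_of_injOn φ hBV hBinj
    have h1 := Metric.mem_ball.1 (hVU (hBV s hs)).1
    have h2 := Metric.mem_ball.1 (hVU (hBV t ht)).1
    have h3 : |φ s - φ t| ≤ 1 / (k + 3) := by
      rw [← Real.dist_eq]
      calc dist (φ s) (φ t) ≤ dist (φ s) a + dist (φ t) a := dist_triangle_right _ _ _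
        _ ≤ 1 / (2 * (k + 3)) + 1 / (2 * (k + 3)) := by gcongr
        _ = 1 / (k + 3) := by field_simp; norm_num
    calc (B.card : ℝ) * |φ s - φ t| ≤ (k + 3) * (1 / (k + 3)) := by
          gcongr
          exact_mod_cast hcard
      _ = 1 := by field_simp
  · -- Two of the `k + 3` points share the integer part of `(k + 1) t`.
    rintro ⟨hcard, hsep⟩
    obtain ⟨s, hs, t, ht, hst, heq⟩ := Finset.exists_ne_map_eq_of_card_lt_of_maps_to
      (s := B) (t := Finset.range (k + 2)) (f := fun t => ⌊((k : ℝ) + 1) * t⌋₊)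
      (by rw [Finset.card_range, hcard, hVcard]; omega) (fun t _ => by
        simp only [Finset.coe_range, Set.mem_Iio]
        rw [Nat.floor_lt (by have := t.2.1; positivity)]
        push_cast
        nlinarith [t.2.2, (Nat.cast_nonneg k : (0 : ℝ) ≤ k)])
    have h := hsep s hs t ht hst
    rw [Subtype.dist_eq, Real.dist_eq, div_le_iff₀' (by positivity)] at h
    have hs0 : (0 : ℝ) ≤ (k + 1) * s := by have := s.2.1; positivity
    have ht0 : (0 : ℝ) ≤ (k + 1) * t := by have := t.2.1; positivity
    have h1 := Nat.floor_le hs0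
    have h2 := Nat.lt_floor_add_one (((k : ℝ) + 1) * s)
    have h3 := Nat.floor_le ht0
    have h4 := Nat.lt_floor_add_one (((k : ℝ) + 1) * t)
    rw [heq] at h1 h2
    rw [← abs_of_pos (show (0 : ℝ) < k + 1 by positivity), ← abs_mul, mul_sub] at h
    have : |((k : ℝ) + 1) * s - (k + 1) * t| < 1 := abs_lt.2 ⟨by linarith, by linarith⟩
    linarith

/-- Outside a finite set of forbidden tags, finitely many sets of a gauge cover the interval up to a
set of small measure. -/
theorem IsGauge.exists_finset_measure_compl_le {δ : unitInterval → Set unitInterval}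
    (hδ : IsGauge δ) (B : Finset unitInterval) {η : ℝ} (hη : 0 < η) :
    ∃ C : Finset unitInterval, Disjoint B C ∧ volume.real (⋃ t ∈ C, δ t)ᶜ ≤ η := by
  obtain ⟨D, hD, hDc, hDun⟩ := TopologicalSpace.isOpen_biUnion_countable
    ((B : Set unitInterval)ᶜ) δ fun t _ => (hδ t).1
  have hnull : volume (⋃ t ∈ D, δ t)ᶜ = 0 := by
    refine measure_mono_null (fun x hx => ?_) (B.finite_toSet.measure_zero volume)
    by_contra hxB
    rw [hDun] at hx
    exact hx (Set.mem_biUnion hxB (hδ x).2)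
  rcases D.eq_empty_or_nonempty with rfl | hne
  · simp at hnull
  obtain ⟨e, rfl⟩ := hDc.exists_eq_range hne
  have hanti : Antitone fun n : ℕ => (⋃ i ∈ Finset.range n, δ (e i))ᶜ := fun m n hmn =>
    Set.compl_subset_compl.2 (Set.biUnion_subset_biUnion_left fun i hi =>
      Finset.mem_range.2 ((Finset.mem_range.1 hi).trans_le hmn))
  have hlim := tendsto_measure_iInter_atTop (μ := volume) (s := fun n : ℕ =>
    (⋃ i ∈ Finset.range n, δ (e i))ᶜ) (fun n => (Finset.measurableSet_biUnion _ fun i _ =>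
      (hδ _).1.measurableSet).compl.nullMeasurableSet) hanti ⟨0, measure_ne_top _ _⟩
  have hInter : (⋂ n : ℕ, (⋃ i ∈ Finset.range n, δ (e i))ᶜ) = (⋃ t ∈ Set.range e, δ t)ᶜ := by
    rw [← Set.compl_iUnion, Set.biUnion_range]
    congr 1
    ext x
    simp only [Set.mem_iUnion, Finset.mem_range, exists_prop]
    exact ⟨fun ⟨n, i, _, hi⟩ => ⟨i, hi⟩, fun ⟨i, hi⟩ => ⟨i + 1, i, i.lt_succ_self, hi⟩⟩
  rw [hInter, hnull] at hlim
  obtain ⟨n, hn⟩ := (hlim.eventually (gt_mem_nhds (ENNReal.ofReal_pos.2 hη))).exists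
  classical
  refine ⟨(Finset.range n).image e, ?_, ?_⟩
  · rw [Finset.disjoint_right]
    intro t ht
    obtain ⟨i, -, rfl⟩ := Finset.mem_image.1 ht
    exact hD ⟨i, rfl⟩
  · rw [Finset.set_biUnion_finset_image]
    exact ENNReal.toReal_le_of_le_ofReal hη.le hn.le

/-- Finitely many sets of a gauge can be shrunk to disjoint sets with the same union, in such a way
that no part of `⋃ t ∈ B, δ t` is given to a tag outside `B`. -/
theorem IsGauge.exists_disjoint_subset {δ : unitInterval → Set unitInterval}
    (hδ : IsGauge δ) {B D : Finset unitInterval} (hBD : B ⊆ D) :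
    ∃ E : unitInterval → Set unitInterval, (∀ t, MeasurableSet (E t)) ∧ (∀ t, E t ⊆ δ t) ∧
      (∀ s ∈ D, ∀ t ∈ D, s ≠ t → Disjoint (E s) (E t)) ∧
      (⋃ t ∈ D, δ t) ⊆ (⋃ t ∈ D, E t) ∧ (⋃ t ∈ B, δ t) ⊆ (⋃ t ∈ B, E t) := by
  classical
  have hδm : ∀ t, MeasurableSet (δ t) := fun t => (hδ t).1.measurableSet
  let W : unitInterval → Set unitInterval := fun t =>
    if t ∈ B then δ t else δ t \ ⋃ s ∈ B, δ s
  have hWm : ∀ t, MeasurableSet (W t) := fun t => by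
    dsimp only [W]
    split_ifs
    exacts [hδm t, (hδm t).diff (Finset.measurableSet_biUnion _ fun s _ => hδm s)]
  have hWδ : ∀ t, W t ⊆ δ t := fun t => by
    dsimp only [W]
    split_ifs
    exacts [subset_rfl, Set.sdiff_subset]
  have hBW : ∀ t x, x ∈ ⋃ s ∈ B, δ s → x ∈ W t → t ∈ B := fun t x hx hxt => by
    by_contra ht
    simp only [W, if_neg ht] at hxt
    exact hxt.2 hx
  let E : unitInterval → Set unitInterval := fun t => W t \ ⋃ s ∈ D.filter (· < t), W s
  -- A point belongs to `E t` for the least `t ∈ D` with `x ∈ W t`.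
  have hE : ∀ x, ∀ s ∈ D, x ∈ W s → ∃ t ∈ D, x ∈ W t ∧ x ∈ E t := fun x s hs hxs => by
    obtain ⟨t, ht, hmin⟩ := (D.filter (x ∈ W ·)).exists_minimal ⟨s, by simp [hs, hxs]⟩
    rw [Finset.mem_filter] at ht
    refine ⟨t, ht.1, ht.2, ht.2, fun hx => ?_⟩
    simp only [Set.mem_iUnion, Finset.mem_filter, exists_prop] at hx
    obtain ⟨r, ⟨hrD, hrt⟩, hxr⟩ := hx
    exact (hmin (Finset.mem_filter.2 ⟨hrD, hxr⟩) hrt.le).not_gt hrt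
  refine ⟨E, fun t => (hWm t).diff (Finset.measurableSet_biUnion _ fun s _ => hWm s),
    fun t => Set.sdiff_subset.trans (hWδ t), ?_, ?_, ?_⟩
  · have key : ∀ s ∈ D, ∀ t, s < t → Disjoint (E s) (E t) := fun s hs t hst => by
      refine Set.disjoint_left.2 fun x hxs hxt => hxt.2 ?_
      exact Set.mem_biUnion (Finset.mem_filter.2 ⟨hs, hst⟩) hxs.1
    intro s hs t ht hst
    rcases hst.lt_or_gt with h | h
    exacts [key s hs t h, (key t ht s h).symm]
  · intro x hx
    obtain ⟨s, hs, hxs⟩ : ∃ s ∈ D, x ∈ W s := by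
      by_cases hxB : x ∈ ⋃ s ∈ B, δ s
      · obtain ⟨s, hs, hxs⟩ := Set.mem_iUnion₂.1 hxB
        exact ⟨s, hBD hs, by simpa only [W, if_pos hs] using hxs⟩
      · obtain ⟨s, hs, hxs⟩ := Set.mem_iUnion₂.1 hx
        refine ⟨s, hs, ?_⟩
        dsimp only [W]
        split_ifs
        exacts [hxs, ⟨hxs, hxB⟩]
    obtain ⟨t, ht, -, hxt⟩ := hE x s hs hxs
    exact Set.mem_biUnion ht hxt
  · intro x hx
    obtain ⟨s, hs, hxs⟩ := Set.mem_iUnion₂.1 hx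
    obtain ⟨t, ht, hxW, hxt⟩ := hE x s (hBD hs) (by simpa only [W, if_pos hs] using hxs)
    exact Set.mem_biUnion (hBW t x hx hxW) hxt

/-- The estimate in the definition of the McShane integral, for partitions indexed by their sets of
tags. -/
theorem HasMcShaneIntegral.exists_gauge_finset {X : Type*} [NormedAddCommGroup X] [NormedSpace ℝ X]
    {f : unitInterval → X} {x : X} (hf : HasMcShaneIntegral volume f x) {ε : ℝ} (hε : 0 < ε) :
    ∃ η : ℝ, 0 < η ∧ ∃ δ : unitInterval → Set unitInterval, IsGauge δ ∧
      ∀ (D : Finset unitInterval) (E : unitInterval → Set unitInterval),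
        (∀ t, MeasurableSet (E t)) → (∀ t, E t ⊆ δ t) →
        (∀ s ∈ D, ∀ t ∈ D, s ≠ t → Disjoint (E s) (E t)) →
        volume.real (⋃ t ∈ D, E t)ᶜ ≤ η →
        ‖∑ t ∈ D, volume.real (E t) • f t - x‖ ≤ ε := by
  obtain ⟨η, hη, δ, hδ, h⟩ := hf ε hε
  refine ⟨η, hη, δ, hδ, fun D E hEm hEδ hEd hEη => ?_⟩
  let e := D.equivFin.symm
  have := h D.card (fun i => E (e i)) (fun i => e i) (fun i => (hEm _).nullMeasurableSet)
    (fun i j hij => hEd _ (e i).2 _ (e j).2 fun h => hij (e.injective (Subtype.ext h)))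
    (by
      rw [e.surjective.iUnion_comp (fun t : D => E t)]
      rwa [← Set.iUnion_subtype (· ∈ D) (fun t => E t)] at hEη) (fun i => hEδ _)
  rwa [e.sum_comp (fun t : D => volume.real (E t) • f t),
    Finset.sum_coe_sort D fun t => volume.real (E t) • f t] at this

/-! ### The coordinate function -/

section Coordinate

variable {F : Set (Finset unitInterval)}

/-- The point of the compact space given by a member of the family. -/
noncomputable def charPoint {A : Finset unitInterval} (hA : A ∈ F) : charFunctions F :=
  ⟨_, A, hA, rfl⟩

theorem sum_smul_subsetIndicator_charPoint {B : Finset unitInterval} (hB : B ∈ F)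
    [DecidableEq unitInterval]
    (D : Finset unitInterval) (m : unitInterval → ℝ) :
    (∑ t ∈ D, m t • subsetIndicator F {t}) (charPoint hB) = ∑ t ∈ D ∩ B, m t := by
  simp only [ContinuousMap.coe_sum, Finset.sum_apply, ContinuousMap.coe_smul, Pi.smul_apply,
    subsetIndicator_apply, charPoint, Finset.mem_singleton, forall_eq, decide_eq_true_eq,
    smul_eq_mul, mul_ite, mul_one, mul_zero, Finset.sum_ite_mem]

variable [IsCompactFamily F]

theorem scalarlyNull_subsetIndicator_singleton :
    ScalarlyNull volume fun t : unitInterval => subsetIndicator F {t} := by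
  intro φ
  have hlim : Tendsto (fun t : unitInterval => φ (subsetIndicator F {t})) cofinite (𝓝 0) :=
    (tendsto_subsetIndicator φ).comp Finset.singleton_injective.tendsto_cofinite
  refine measure_mono_null (t := ⋃ n : ℕ, {t | ¬ dist (φ (subsetIndicator F {t})) 0 < 1 / (n + 1)})
    (fun t ht => ?_) (Set.Countable.measure_zero ?_ volume)
  · obtain ⟨n, hn⟩ := exists_nat_one_div_lt (dist_pos.2 ht)
    exact Set.mem_iUnion.2 ⟨n, hn.not_gt⟩
  · refine Set.countable_iUnion fun n => Set.Finite.countable ?_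
    exact Metric.tendsto_nhds.1 hlim _ (by positivity)

/-- Evaluation at `1_B` does not see tags outside the finite set `B`, and such tags suffice for a
partition; so the McShane integral could only be `0`. -/
theorem HasMcShaneIntegral.eq_zero_of_subsetIndicator {x : C(charFunctions F, ℝ)}
    (hx : HasMcShaneIntegral volume (fun t : unitInterval => subsetIndicator F {t}) x) : x = 0 := by
  classical
  ext ⟨_, B, hB, rfl⟩
  change x (charPoint hB) = 0
  rw [← abs_nonpos_iff]
  refine le_of_forall_pos_le_add fun ε hε => ?_
  obtain ⟨η, hη, δ, hδ, h⟩ := hx.exists_gauge_finset hε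
  obtain ⟨C, hBC, hC⟩ := hδ.exists_finset_measure_compl_le B hη
  obtain ⟨E, hEm, hEδ, hEd, hEC, -⟩ := hδ.exists_disjoint_subset C.empty_subset
  have h1 := h C E hEm hEδ hEd
    ((measureReal_mono (Set.compl_subset_compl.2 hEC)).trans hC)
  have h2 := (ContinuousMap.norm_coe_le_norm _ (charPoint hB)).trans h1
  rw [ContinuousMap.sub_apply, sum_smul_subsetIndicator_charPoint, Finset.inter_comm,
    Finset.disjoint_iff_inter_eq_empty.1 hBC] at h2
  simpa using h2

/-- If members of the family fill a fixed proportion of the interval for each gauge, the Riemann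
sums of the coordinate function do not become small. -/
theorem not_mcShaneIntegrable_of_filling {c : ℝ≥0} (hc : 0 < c)
    (hF : ∀ δ : unitInterval → Set unitInterval, IsGauge δ →
      ∃ B ∈ F, (c : ℝ≥0∞) ≤ volume (⋃ t ∈ B, δ t)) :
    ¬ McShaneIntegrable volume fun t : unitInterval => subsetIndicator F {t} := by
  classical
  rintro ⟨x, hx⟩
  obtain rfl := hx.eq_zero_of_subsetIndicator
  obtain ⟨η, hη, δ, hδ, h⟩ := hx.exists_gauge_finset (ε := c / 2) (by positivity)
  obtain ⟨B, hB, hBc⟩ := hF δ hδ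
  obtain ⟨C, -, hC⟩ := hδ.exists_finset_measure_compl_le B hη
  obtain ⟨E, hEm, hEδ, hEd, hED, hEB⟩ := hδ.exists_disjoint_subset
    (Finset.subset_union_left : B ⊆ B ∪ C)
  have hCD : (⋃ t ∈ C, δ t) ⊆ ⋃ t ∈ B ∪ C, δ t :=
    Set.biUnion_subset_biUnion_left fun t ht => Finset.mem_union_right _ ht
  have h1 := h (B ∪ C) E hEm hEδ hEd
    ((measureReal_mono (Set.compl_subset_compl.2 (hCD.trans hED))).trans hC)
  have h2 := (ContinuousMap.norm_coe_le_norm _ (charPoint hB)).trans h1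
  rw [sub_zero, sum_smul_subsetIndicator_charPoint,
    Finset.inter_eq_right.2 Finset.subset_union_left, ← measureReal_biUnion_finset
      (fun s hs t ht hst => hEd s (Finset.mem_union_left _ hs) t (Finset.mem_union_left _ ht) hst)
      fun t _ => hEm t] at h2
  have h3 : (c : ℝ) ≤ volume.real (⋃ t ∈ B, E t) :=
    ENNReal.toReal_mono (measure_ne_top _ _) (hBc.trans (measure_mono hEB))
  have h4 := (le_abs_self _).trans h2
  have h5 : (0 : ℝ) < c := hc
  linarith

end Coordinate

theorem ScalarlyNull.pettisIntegrable {Ω X : Type*} [MeasurableSpace Ω] [NormedAddCommGroup X]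
    [NormedSpace ℝ X] {μ : Measure Ω} {f : Ω → X} (hf : ScalarlyNull μ f) :
    PettisIntegrable μ f := by
  refine ⟨fun φ => (integrable_zero Ω ℝ μ).congr
    (EventuallyEq.symm (hf φ)), fun E _ => ⟨0, fun φ => ?_⟩⟩
  rw [map_zero, integral_eq_zero_of_ae (ae_restrict_of_ae (hf φ))]

theorem theorem3p5 :
    ∃ (F : Set (Finset unitInterval)) (_ : IsCompactFamily F),
      IsHereditary F ∧
      IsWCG C(charFunctions F, ℝ) ∧
      ∃ f : unitInterval → C(charFunctions F, ℝ),
        ScalarlyNull volume f ∧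
        PettisIntegrable volume f ∧
        ¬ McShaneIntegrable volume f := by
  obtain ⟨φ, c, hc, hφ⟩ := exists_fibres_outer_measure_ge
  have hcompact := isCompactFamily_clusterFamily φ
  exact ⟨clusterFamily φ, hcompact, isHereditary_clusterFamily φ, isWCG_of_isCompactFamily,
    fun t => subsetIndicator _ {t}, scalarlyNull_subsetIndicator_singleton,
    scalarlyNull_subsetIndicator_singleton.pettisIntegrable,
    not_mcShaneIntegrable_of_filling (half_pos hc) fun δ hδ =>
      exists_mem_clusterFamily_measure_ge hc hφ hδ⟩
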